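/- All graphs are simple and considered up to isomorphism. Let $G$ be a $4$-regular graph, let $\{v_1,v_2,v_3\}$ be a triangle of $G$, and let $\{v_2,v_4\}$ be an edge of $G$ with $v_4\notin\{v_1,v_3\}$. The corresponding double triangle expansion of $G$ is the graph obtained from $G$ by subdividing each of the edges $\{v_1,v_3\}$ and $\{v_2,v_4\}$ by one new vertex and identifying these two new vertices; equivalently, the edges $\{v_1,v_3\}$ and $\{v_2,v_4\}$ are deleted and a new vertex adjacent to exactly $v_1,v_2,v_3,v_4$ is added. (The result is again a simple $4$-regular graph.) A double triangle descendant of $K_5$ is a graph that can be obtained from the complete graph $K_5$ by a finite (possibly empty) sequence of double triangle expansions. For a graph $G$, let $\mathrm{tri}(G)$ denote the number of triangles of $G$, that is, the number of $3$-element sets of pairwise adjacent vertices. Theorem. If $G$ is a double triangle descendant of $K_5$, then $\mathrm{tri}(G)\ge 4$. -/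

import Mathlib

universe u v

/-- Double triangle expansion of `G` at the configuration consisting of the triangle `a, b, c` and
the additional edge `ad` (these requirements are imposed in `IsDTEChild`): the edges `bc` and `ad`
are subdivided and the two newly created vertices are identified to one new vertex `none`.
That is, the edges `bc` and `ad` are deleted, and `none` is joined to `a`, `b`, `c` and `d`. -/
def doubleTriangleExpansion {V : Type u} (G : SimpleGraph V) (a b c d : V) :
    SimpleGraph (Option V) where
  Adj
    | some p, some q => G.Adj p q ∧ s(p, q) ≠ s(b, c) ∧ s(p, q) ≠ s(a, d)
    | some p, none => p = a ∨ p = b ∨ p = c ∨ p = d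
    | none, some q => q = a ∨ q = b ∨ q = c ∨ q = d
    | none, none => False
  symm := ⟨by
    rintro (_ | p) (_ | q) h
    · exact h
    · exact h
    · exact h
    · exact ⟨h.1.symm, by rw [Sym2.eq_swap]; exact h.2.1, by rw [Sym2.eq_swap]; exact h.2.2⟩⟩
  loopless := ⟨by
    rintro (_ | p) h
    · exact h
    · exact G.irrefl h.1⟩

/-- `H` is a child of `G`: it is isomorphic to the result of one double triangle expansion of `G`,
performed at some triangle `a, b, c` of `G`, some vertex `a` of this triangle, and some neighbour
`d` of `a` outside the triangle. -/
def IsDTEChild {V : Type u} {W : Type v} (G : SimpleGraph V) (H : SimpleGraph W) : Prop :=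
  ∃ a b c d : V, G.Adj a b ∧ G.Adj a c ∧ G.Adj b c ∧ G.Adj a d ∧ d ≠ b ∧ d ≠ c ∧
    Nonempty (H ≃g doubleTriangleExpansion G a b c d)

/-- The double triangle descendants of a graph `A`: the graphs (up to isomorphism) which can be
obtained from `A` by finitely many, possibly zero, double triangle expansions. -/
inductive IsDTDescendant {U : Type v} (A : SimpleGraph U) : ∀ {V : Type u}, SimpleGraph V → Prop
  | refl {V : Type u} {G : SimpleGraph V} : Nonempty (G ≃g A) → IsDTDescendant A G
  | step {V W : Type u} {G : SimpleGraph V} {H : SimpleGraph W} :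
      IsDTDescendant A G → IsDTEChild G H → IsDTDescendant A H

/-- The number of triangles of a graph. -/
noncomputable def tri {V : Type u} (G : SimpleGraph V) : ℕ := (G.cliqueSet 3).ncard

/-!
The triangle count itself can drop under a double triangle expansion, so the induction runs over a
stronger property of `4`-regular graphs, `IsTriangleRich`. It speaks about edge cuts: a cut with at
least two vertices on either side has at least six edges, and a side `S` of a cut with exactly six
edges contains two triangles, provided that `S` has at least four vertices and its complement at
least three.

This property is preserved (`IsTriangleRich.expansion`). The expansion replaces the edges `bc` and
`ad` by paths through the new vertex `x`, so cuts do not get smaller, and a six-edge cut of the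
expanded graph restricts to a six-edge cut of `G` as soon as the restriction has two vertices on
either side. Two triangles of `G` on the side in question are then available. They survive unless
they contain `bc` or `ad`, and where one does, a triangle through `x` on the same side makes up
for it. The sides of six-edge cuts which become too small in `G` are treated separately: four
vertices that induce five edges always form two triangles, and if the other side shrinks to an
edge of `G`, then this edge lies in a triangle of `G`, whose complement is used instead.

The bound follows because the complement of the triangle `xab` is a side of a six-edge cut: if the
expanded graph has at least seven vertices, two triangles avoid `x`, while `xab` and `xac` contain
it. With six vertices the expansion is one of `K₅`, and `xab, xac, xbd, xcd` are triangles.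
-/

section

variable {V : Type*}

/-! ### Edges within a set of vertices -/

open Classical in
/-- The indicator of adjacency, i.e. the entries of the adjacency matrix over `ℤ`. -/
noncomputable def adjInd (G : SimpleGraph V) (p q : V) : ℤ := if G.Adj p q then 1 else 0

lemma adjInd_of_adj {G : SimpleGraph V} {p q : V} (h : G.Adj p q) : adjInd G p q = 1 := if_pos h

lemma adjInd_of_not_adj {G : SimpleGraph V} {p q : V} (h : ¬ G.Adj p q) : adjInd G p q = 0 :=
  if_neg h

@[simp] lemma adjInd_self (G : SimpleGraph V) (p : V) : adjInd G p p = 0 :=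
  adjInd_of_not_adj G.irrefl

lemma adjInd_congr {W : Type*} {G : SimpleGraph V} {H : SimpleGraph W} {p q : V} {r s : W}
    (h : G.Adj p q ↔ H.Adj r s) : adjInd G p q = adjInd H r s := by
  by_cases h' : G.Adj p q
  · rw [adjInd_of_adj h', adjInd_of_adj (h.1 h')]
  · rw [adjInd_of_not_adj h', adjInd_of_not_adj (mt h.2 h')]

lemma adjInd_comm (G : SimpleGraph V) (p q : V) : adjInd G p q = adjInd G q p :=
  adjInd_congr (G.adj_comm p q)

lemma adjInd_le_one (G : SimpleGraph V) (p q : V) : adjInd G p q ≤ 1 := by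
  unfold adjInd; split_ifs <;> simp

lemma adjInd_cases (G : SimpleGraph V) (p q : V) :
    (G.Adj p q ∧ adjInd G p q = 1) ∨ (¬ G.Adj p q ∧ adjInd G p q = 0) := by
  by_cases h : G.Adj p q
  · exact .inl ⟨h, adjInd_of_adj h⟩
  · exact .inr ⟨h, adjInd_of_not_adj h⟩

/-- The sum of the degrees of the subgraph induced on `S`, i.e. twice its number of edges. In a
`4`-regular graph exactly `4 * #S - inducedDegreeSum G S` edges leave `S`. -/
noncomputable def inducedDegreeSum (G : SimpleGraph V) (S : Finset V) : ℤ :=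
  ∑ p ∈ S, ∑ q ∈ S, adjInd G p q

/-- At least two triangles of `G` have all their vertices in `S`. -/
def HasTwoTriangles (G : SimpleGraph V) (S : Finset V) : Prop :=
  ∃ T₁ T₂ : Finset V, T₁ ≠ T₂ ∧ T₁ ⊆ S ∧ T₂ ⊆ S ∧ G.IsNClique 3 T₁ ∧ G.IsNClique 3 T₂

/-- The property of finite `4`-regular graphs which is preserved by double triangle expansions. -/
structure IsTriangleRich [Fintype V] (G : SimpleGraph V) : Prop where
  five_le_card : 5 ≤ Fintype.card V
  regular : ∀ p, ∑ q, adjInd G p q = 4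
  /-- Every edge cut with at least two vertices on either side has at least six edges. -/
  six_le_cut : ∀ S : Finset V, 2 ≤ S.card → S.card + 2 ≤ Fintype.card V →
    inducedDegreeSum G S + 6 ≤ 4 * S.card
  /-- A side of a six-edge cut with at least four vertices has two triangles, if there are at
  least three vertices on the other side. -/
  hasTwoTriangles : ∀ S : Finset V, 4 ≤ S.card → S.card + 3 ≤ Fintype.card V →
    inducedDegreeSum G S + 6 = 4 * S.card → HasTwoTriangles G S

lemma HasTwoTriangles.mono {G : SimpleGraph V} {S T : Finset V} (h : HasTwoTriangles G S)
    (hST : S ⊆ T) : HasTwoTriangles G T := by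
  obtain ⟨T₁, T₂, hne, h₁, h₂, c₁, c₂⟩ := h
  exact ⟨T₁, T₂, hne, h₁.trans hST, h₂.trans hST, c₁, c₂⟩

lemma inducedDegreeSum_insert [DecidableEq V] (G : SimpleGraph V) {S : Finset V} {v : V}
    (hv : v ∉ S) :
    inducedDegreeSum G (insert v S) = inducedDegreeSum G S + 2 * ∑ u ∈ S, adjInd G v u := by
  unfold inducedDegreeSum
  rw [Finset.sum_insert hv]
  simp only [Finset.sum_insert hv, Finset.sum_add_distrib, adjInd_self]
  rw [Finset.sum_congr rfl fun p _ => adjInd_comm G p v]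
  ring

lemma inducedDegreeSum_singleton (G : SimpleGraph V) (p : V) : inducedDegreeSum G {p} = 0 := by
  simp [inducedDegreeSum]

lemma inducedDegreeSum_pair [DecidableEq V] (G : SimpleGraph V) {p q : V} (h : p ≠ q) :
    inducedDegreeSum G {p, q} = 2 * adjInd G p q := by
  rw [inducedDegreeSum_insert G (by simpa using h), inducedDegreeSum_singleton]
  simp

lemma inducedDegreeSum_triple [DecidableEq V] (G : SimpleGraph V) {p q r : V} (hpq : p ≠ q)
    (hpr : p ≠ r) (hqr : q ≠ r) :
    inducedDegreeSum G {p, q, r} = 2 * (adjInd G p q + adjInd G p r + adjInd G q r) := by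
  rw [inducedDegreeSum_insert G (by simp [hpq, hpr]), inducedDegreeSum_pair G hqr,
    Finset.sum_pair hqr]
  ring

lemma inducedDegreeSum_of_isNClique [DecidableEq V] {G : SimpleGraph V} {p q r : V}
    (hpq : G.Adj p q) (hpr : G.Adj p r) (hqr : G.Adj q r) :
    inducedDegreeSum G {p, q, r} = 6 := by
  rw [inducedDegreeSum_triple G hpq.ne hpr.ne hqr.ne, adjInd_of_adj hpq, adjInd_of_adj hpr,
    adjInd_of_adj hqr]
  norm_num

/-- As many edges leave `S` as leave its complement. -/
lemma inducedDegreeSum_compl [Fintype V] [DecidableEq V] {G : SimpleGraph V}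
    (hG : ∀ p, ∑ q, adjInd G p q = 4) (S : Finset V) :
    4 * (Sᶜ.card : ℤ) - inducedDegreeSum G Sᶜ = 4 * S.card - inducedDegreeSum G S := by
  have key : ∀ T : Finset V, 4 * (T.card : ℤ) - inducedDegreeSum G T
      = ∑ p ∈ T, ∑ q ∈ Tᶜ, adjInd G p q := by
    intro T
    have : ∑ p ∈ T, (∑ q ∈ T, adjInd G p q + ∑ q ∈ Tᶜ, adjInd G p q) = 4 * T.card := by
      simp [Finset.sum_add_sum_compl, hG, mul_comm]
    rw [Finset.sum_add_distrib] at this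
    unfold inducedDegreeSum
    linarith
  rw [key, key, compl_compl, Finset.sum_comm]
  simp only [adjInd_comm]

/-- Four vertices inducing five edges form two triangles with a common edge. -/
lemma hasTwoTriangles_of_card_eq_four {G : SimpleGraph V} {S : Finset V} (hS : S.card = 4)
    (h : inducedDegreeSum G S = 10) : HasTwoTriangles G S := by
  classical
  obtain ⟨p, q, r, s, hpq, hpr, hps, hqr, hqs, hrs, rfl⟩ := Finset.card_eq_four.1 hS
  rw [inducedDegreeSum_insert G (by simp [hpq, hpr, hps]), inducedDegreeSum_triple G hqr hqs hrs,
    Finset.sum_insert (by simp [hqr, hqs]), Finset.sum_pair hrs] at h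
  have key : ∀ {u v w t : V}, u ≠ v → G.Adj w t → G.Adj u w → G.Adj u t → G.Adj v w → G.Adj v t →
      {u, v, w, t} ⊆ ({p, q, r, s} : Finset V) → HasTwoTriangles G {p, q, r, s} := by
    intro u v w t huv h1 h2 h3 h4 h5 hsub
    refine ⟨{u, w, t}, {v, w, t}, ?_, ?_, ?_, ?_, ?_⟩
    · intro heq
      have : u ∈ ({v, w, t} : Finset V) := heq ▸ by simp
      simp [huv, h2.ne, h3.ne] at this
    · exact subset_trans (by intro z; simp; tauto) hsub
    · exact subset_trans (by intro z; simp; tauto) hsub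
    · exact SimpleGraph.is3Clique_triple_iff.2 ⟨h2, h3, h1⟩
    · exact SimpleGraph.is3Clique_triple_iff.2 ⟨h4, h5, h1⟩
  have l1 := adjInd_le_one G p q
  have l2 := adjInd_le_one G p r
  have l3 := adjInd_le_one G p s
  have l4 := adjInd_le_one G q r
  have l5 := adjInd_le_one G q s
  have l6 := adjInd_le_one G r s
  have of_one : ∀ {u v : V}, adjInd G u v = 1 → G.Adj u v := by
    intro u v h
    rcases adjInd_cases G u v with h' | h'
    · exact h'.1
    · omega
  -- Exactly one of the six pairs is not an edge.
  rcases adjInd_cases G p q with ⟨a1, e1⟩ | ⟨a1, e1⟩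
  · rcases adjInd_cases G p r with ⟨a2, e2⟩ | ⟨a2, e2⟩
    · rcases adjInd_cases G p s with ⟨a3, e3⟩ | ⟨a3, e3⟩
      · rcases adjInd_cases G q r with ⟨a4, e4⟩ | ⟨a4, e4⟩
        · rcases adjInd_cases G q s with ⟨a5, e5⟩ | ⟨a5, e5⟩
          · exact key hrs a1 a2.symm a4.symm a3.symm a5.symm (by intro z; simp; tauto)
          · exact key hqs a2 a1.symm a4 a3.symm (of_one (by omega : adjInd G r s = 1)).symm
              (by intro z; simp; tauto)
        · exact key hqr a3 a1.symm (of_one (by omega)) a2.symm (of_one (by omega))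
            (by intro z; simp; tauto)
      · exact key hps (of_one (by omega : adjInd G q r = 1)) a1 a2
          (of_one (by omega : adjInd G q s = 1)).symm (of_one (by omega : adjInd G r s = 1)).symm
          (by intro z; simp; tauto)
    · exact key hpr (of_one (by omega : adjInd G q s = 1)) a1 (of_one (by omega))
        (of_one (by omega : adjInd G q r = 1)).symm (of_one (by omega)) (by intro z; simp; tauto)
  · exact key hpq (of_one (by omega : adjInd G r s = 1)) (of_one (by omega)) (of_one (by omega))
      (of_one (by omega)) (of_one (by omega)) subset_rfl

/-! ### Isomorphisms and the complete graph -/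

lemma isNClique_map_of_iso {W : Type*} {G : SimpleGraph V} {H : SimpleGraph W} (e : G ≃g H)
    {n : ℕ} {T : Finset V} (hT : G.IsNClique n T) :
    H.IsNClique n (T.map e.toEquiv.toEmbedding) := by
  refine SimpleGraph.IsNClique.mono ?_ (hT.map (f := e.toEquiv.toEmbedding))
  rw [SimpleGraph.map_le_iff_le_comap]
  exact fun p q h => e.map_adj_iff.2 h

lemma tri_le_of_iso {V : Type u} {W : Type v} [Finite W] {G : SimpleGraph V} {H : SimpleGraph W}
    (e : G ≃g H) : tri G ≤ tri H :=
  Set.ncard_le_ncard_of_injOn (fun T => T.map e.toEquiv.toEmbedding)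
    (fun _ hT => isNClique_map_of_iso e hT) (Finset.map_injective _).injOn (Set.toFinite _)

lemma IsTriangleRich.of_iso {W : Type*} [Fintype V] [Fintype W] {G : SimpleGraph V}
    {H : SimpleGraph W} (e : G ≃g H) (hG : IsTriangleRich G) : IsTriangleRich H := by
  have hadj : ∀ p q, adjInd H (e p) (e q) = adjInd G p q := fun p q =>
    adjInd_congr e.map_adj_iff
  have hcard : Fintype.card W = Fintype.card V := (Fintype.card_congr e.toEquiv).symm
  have hsum : ∀ S : Finset V,
      inducedDegreeSum H (S.map e.toEquiv.toEmbedding) = inducedDegreeSum G S := fun S => by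
    simp only [inducedDegreeSum, Finset.sum_map]
    exact Finset.sum_congr rfl fun p _ => Finset.sum_congr rfl fun q _ => hadj p q
  have hsurj : ∀ S : Finset W, ∃ T : Finset V, S = T.map e.toEquiv.toEmbedding := fun S =>
    ⟨S.map e.toEquiv.symm.toEmbedding, by ext x; simp [Finset.mem_map_equiv]⟩
  refine ⟨hcard ▸ hG.five_le_card, fun p => ?_, fun S h1 h2 => ?_, fun S h1 h2 h3 => ?_⟩
  · obtain ⟨p, rfl⟩ := e.surjective p
    rw [← hG.regular p, ← e.toEquiv.sum_comp]
    exact Finset.sum_congr rfl fun q _ => hadj p q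
  · obtain ⟨S, rfl⟩ := hsurj S
    rw [hsum]
    rw [Finset.card_map] at *
    exact hG.six_le_cut S h1 (hcard ▸ h2)
  · obtain ⟨S, rfl⟩ := hsurj S
    rw [hsum] at h3
    rw [Finset.card_map] at *
    obtain ⟨T₁, T₂, hne, s₁, s₂, c₁, c₂⟩ := hG.hasTwoTriangles S h1 (hcard ▸ h2) h3
    exact ⟨_, _, fun h => hne (Finset.map_injective _ h), Finset.map_subset_map.2 s₁,
      Finset.map_subset_map.2 s₂, isNClique_map_of_iso e c₁, isNClique_map_of_iso e c₂⟩

lemma four_le_tri {V : Type u} [Finite V] {G : SimpleGraph V} {T₁ T₂ T₃ T₄ : Finset V}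
    (h₁ : G.IsNClique 3 T₁) (h₂ : G.IsNClique 3 T₂) (h₃ : G.IsNClique 3 T₃)
    (h₄ : G.IsNClique 3 T₄) (h₁₂ : T₁ ≠ T₂) (h₁₃ : T₁ ≠ T₃) (h₁₄ : T₁ ≠ T₄) (h₂₃ : T₂ ≠ T₃)
    (h₂₄ : T₂ ≠ T₄) (h₃₄ : T₃ ≠ T₄) : 4 ≤ tri G := by
  classical
  have hc : ({T₁, T₂, T₃, T₄} : Finset (Finset V)).card = 4 :=
    Finset.card_eq_four.2 ⟨_, _, _, _, h₁₂, h₁₃, h₁₄, h₂₃, h₂₄, h₃₄, rfl⟩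
  rw [← hc, ← Set.ncard_coe_finset]
  refine Set.ncard_le_ncard (fun T hT => ?_) (Set.toFinite _)
  simp only [Finset.coe_insert, Finset.coe_singleton, Set.mem_insert_iff,
    Set.mem_singleton_iff] at hT
  rcases hT with rfl | rfl | rfl | rfl <;> assumption

lemma four_le_tri_completeGraph_five : 4 ≤ tri (SimpleGraph.completeGraph (Fin 5)) := by
  have h : ∀ {p q r : Fin 5}, p ≠ q → p ≠ r → q ≠ r →
      (SimpleGraph.completeGraph (Fin 5)).IsNClique 3 {p, q, r} := fun h1 h2 h3 =>
    SimpleGraph.is3Clique_triple_iff.2 ⟨h1, h2, h3⟩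
  refine four_le_tri (T₁ := {0, 1, 2}) (T₂ := {0, 1, 3}) (T₃ := {0, 1, 4}) (T₄ := {0, 2, 3})
    (h ?_ ?_ ?_) (h ?_ ?_ ?_) (h ?_ ?_ ?_) (h ?_ ?_ ?_) ?_ ?_ ?_ ?_ ?_ ?_ <;> decide

lemma isTriangleRich_completeGraph_five :
    IsTriangleRich (SimpleGraph.completeGraph (Fin 5)) := by
  have hadj : ∀ p q, adjInd (SimpleGraph.completeGraph (Fin 5)) p q = if p = q then 0 else 1 :=
    fun p q => by
      split_ifs with h
      · exact h ▸ adjInd_self _ _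
      · exact adjInd_of_adj h
  refine ⟨by simp, fun p => ?_, fun S h1 h2 => ?_, fun S h1 h2 => ?_⟩
  · simp only [hadj]
    revert p
    decide
  · simp only [inducedDegreeSum, hadj]
    revert S
    decide
  · rw [Fintype.card_fin] at h2
    omega

/-! ### Edges and triangles of the expansion -/

section Expansion

variable {G : SimpleGraph V} {a b c d : V}

lemma doubleTriangleExpansion_swap (G : SimpleGraph V) (a b c d : V) :
    doubleTriangleExpansion G a b c d = doubleTriangleExpansion G a c b d := by
  ext (_ | p) (_ | q)
  · exact Iff.rfl
  · change (q = a ∨ q = b ∨ q = c ∨ q = d) ↔ (q = a ∨ q = c ∨ q = b ∨ q = d)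
    tauto
  · change (p = a ∨ p = b ∨ p = c ∨ p = d) ↔ (p = a ∨ p = c ∨ p = b ∨ p = d)
    tauto
  · change (_ ∧ s(p, q) ≠ s(b, c) ∧ _) ↔ (_ ∧ s(p, q) ≠ s(c, b) ∧ _)
    rw [Sym2.eq_swap (a := b)]

lemma adjInd_expansion_none_some [DecidableEq V] (hab : G.Adj a b) (hac : G.Adj a c)
    (hbc : G.Adj b c) (had : G.Adj a d) (hdb : d ≠ b) (hdc : d ≠ c) (q : V) :
    adjInd (doubleTriangleExpansion G a b c d) none (some q) =
      (if q = a then 1 else 0) + (if q = b then 1 else 0) + (if q = c then 1 else 0) +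
        (if q = d then 1 else 0) := by
  by_cases h : q = a ∨ q = b ∨ q = c ∨ q = d
  · rw [adjInd_of_adj (show (doubleTriangleExpansion G a b c d).Adj none (some q) from h)]
    rcases h with rfl | rfl | rfl | rfl
    · simp [hab.ne, hac.ne, had.ne]
    · simp [hab.ne', hbc.ne, hdb.symm]
    · simp [hac.ne', hbc.ne', hdc.symm]
    · simp [had.ne', hdb, hdc]
  · rw [adjInd_of_not_adj (show ¬ (doubleTriangleExpansion G a b c d).Adj none (some q) from h)]
    push Not at h
    simp [h]

lemma adjInd_expansion_some_some [DecidableEq V] (hab : G.Adj a b) (hac : G.Adj a c)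
    (hbc : G.Adj b c) (had : G.Adj a d) (hdb : d ≠ b) (hdc : d ≠ c) (p q : V) :
    adjInd (doubleTriangleExpansion G a b c d) (some p) (some q) = adjInd G p q -
      (if p = b then 1 else 0) * (if q = c then 1 else 0) -
      (if p = c then 1 else 0) * (if q = b then 1 else 0) -
      (if p = a then 1 else 0) * (if q = d then 1 else 0) -
      (if p = d then 1 else 0) * (if q = a then 1 else 0) := by
  by_cases h1 : s(p, q) = s(b, c)
  · have : ¬ (doubleTriangleExpansion G a b c d).Adj (some p) (some q) := fun h => h.2.1 h1
    rw [adjInd_of_not_adj this]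
    rcases Sym2.eq_iff.1 h1 with ⟨rfl, rfl⟩ | ⟨rfl, rfl⟩
    · simp [adjInd_of_adj hbc, hbc.ne, hab.ne', hdb.symm]
    · simp [adjInd_of_adj hbc.symm, hbc.ne', hac.ne', hdc.symm]
  by_cases h2 : s(p, q) = s(a, d)
  · have : ¬ (doubleTriangleExpansion G a b c d).Adj (some p) (some q) := fun h => h.2.2 h2
    rw [adjInd_of_not_adj this]
    rcases Sym2.eq_iff.1 h2 with ⟨rfl, rfl⟩ | ⟨rfl, rfl⟩
    · simp [adjInd_of_adj had, had.ne, hab.ne, hac.ne]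
    · simp [adjInd_of_adj had.symm, had.ne', hdb, hdc]
  rw [adjInd_congr (show (doubleTriangleExpansion G a b c d).Adj (some p) (some q) ↔ G.Adj p q
    from ⟨fun h => h.1, fun h => ⟨h, h1, h2⟩⟩)]
  rw [Sym2.eq_iff] at h1 h2
  push Not at h1 h2
  have e1 : (if p = b then (1 : ℤ) else 0) * (if q = c then 1 else 0) = 0 := by
    split_ifs <;> simp_all
  have e2 : (if p = c then (1 : ℤ) else 0) * (if q = b then 1 else 0) = 0 := by
    split_ifs <;> simp_all
  have e3 : (if p = a then (1 : ℤ) else 0) * (if q = d then 1 else 0) = 0 := by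
    split_ifs <;> simp_all
  have e4 : (if p = d then (1 : ℤ) else 0) * (if q = a then 1 else 0) = 0 := by
    split_ifs <;> simp_all
  rw [e1, e2, e3, e4]
  ring

lemma sum_adjInd_expansion [Fintype V] (hG : ∀ p, ∑ q, adjInd G p q = 4) (hab : G.Adj a b)
    (hac : G.Adj a c) (hbc : G.Adj b c) (had : G.Adj a d) (hdb : d ≠ b) (hdc : d ≠ c)
    (p : Option V) : ∑ q, adjInd (doubleTriangleExpansion G a b c d) p q = 4 := by
  classical
  rw [Fintype.sum_option]
  rcases p with _ | p
  · simp [adjInd_expansion_none_some hab hac hbc had hdb hdc, Finset.sum_add_distrib]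
  · rw [adjInd_comm, adjInd_expansion_none_some hab hac hbc had hdb hdc]
    simp only [adjInd_expansion_some_some hab hac hbc had hdb hdc, Finset.sum_sub_distrib,
      ← Finset.mul_sum, hG, Finset.sum_ite_eq', Finset.mem_univ, if_true]
    ring

/-- The edges within `S` which are destroyed by the expansion are `bc` and `ad`. -/
lemma inducedDegreeSum_expansion_map_some [DecidableEq V] (hab : G.Adj a b) (hac : G.Adj a c)
    (hbc : G.Adj b c) (had : G.Adj a d) (hdb : d ≠ b) (hdc : d ≠ c) (S : Finset V) :
    inducedDegreeSum (doubleTriangleExpansion G a b c d) (S.map .some) = inducedDegreeSum G S -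
      2 * ((if b ∈ S then 1 else 0) * (if c ∈ S then 1 else 0)) -
      2 * ((if a ∈ S then 1 else 0) * (if d ∈ S then 1 else 0)) := by
  simp only [inducedDegreeSum, Finset.sum_map, Function.Embedding.some_apply,
    adjInd_expansion_some_some hab hac hbc had hdb hdc, Finset.sum_sub_distrib,
    ← Finset.mul_sum, ← Finset.sum_mul, Finset.sum_ite_eq']
  ring

lemma inducedDegreeSum_expansion_insertNone [DecidableEq V] (hab : G.Adj a b) (hac : G.Adj a c)
    (hbc : G.Adj b c) (had : G.Adj a d) (hdb : d ≠ b) (hdc : d ≠ c) (S : Finset V) :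
    inducedDegreeSum (doubleTriangleExpansion G a b c d) (Finset.insertNone S) =
      inducedDegreeSum G S -
      2 * ((if b ∈ S then 1 else 0) * (if c ∈ S then 1 else 0)) -
      2 * ((if a ∈ S then 1 else 0) * (if d ∈ S then 1 else 0)) +
      2 * ((if a ∈ S then 1 else 0) + (if b ∈ S then 1 else 0) + (if c ∈ S then 1 else 0) +
        (if d ∈ S then 1 else 0)) := by
  have : Finset.insertNone S = insert none (S.map .some) := by
    ext (_ | p) <;> simp
  rw [this, inducedDegreeSum_insert _ (by simp),
    inducedDegreeSum_expansion_map_some hab hac hbc had hdb hdc]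
  simp [adjInd_expansion_none_some hab hac hbc had hdb hdc, Finset.sum_add_distrib]

lemma exists_eq_map_some_or_eq_insertNone (S : Finset (Option V)) :
    ∃ T : Finset V, S = T.map .some ∨ S = Finset.insertNone T := by
  refine ⟨S.eraseNone, ?_⟩
  by_cases h : none ∈ S
  · right
    ext (_ | p) <;> simp [h]
  · left
    ext (_ | p) <;> simp [h]

lemma isNClique_expansion_map_some {n : ℕ} {T : Finset V} (hT : G.IsNClique n T)
    (hbc : ¬ (b ∈ T ∧ c ∈ T)) (had : ¬ (a ∈ T ∧ d ∈ T)) :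
    (doubleTriangleExpansion G a b c d).IsNClique n (T.map .some) := by
  refine ⟨?_, by rw [Finset.card_map, hT.card_eq]⟩
  intro x hx y hy hxy
  simp only [Finset.coe_map, Set.mem_image, Finset.mem_coe] at hx hy
  obtain ⟨p, hp, rfl⟩ := hx
  obtain ⟨q, hq, rfl⟩ := hy
  refine ⟨hT.isClique hp hq fun h => hxy (h ▸ rfl), fun h => hbc ?_, fun h => had ?_⟩
  · rcases Sym2.eq_iff.1 h with ⟨rfl, rfl⟩ | ⟨rfl, rfl⟩
    · exact ⟨hp, hq⟩
    · exact ⟨hq, hp⟩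
  · rcases Sym2.eq_iff.1 h with ⟨rfl, rfl⟩ | ⟨rfl, rfl⟩
    · exact ⟨hp, hq⟩
    · exact ⟨hq, hp⟩

lemma HasTwoTriangles.expansion {S : Finset V} (h : HasTwoTriangles G S)
    (hbc : ¬ (b ∈ S ∧ c ∈ S)) (had : ¬ (a ∈ S ∧ d ∈ S)) :
    HasTwoTriangles (doubleTriangleExpansion G a b c d) (S.map .some) := by
  obtain ⟨T₁, T₂, hne, s₁, s₂, c₁, c₂⟩ := h
  exact ⟨_, _, fun h => hne (Finset.map_injective _ h), Finset.map_subset_map.2 s₁,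
    Finset.map_subset_map.2 s₂,
    isNClique_expansion_map_some c₁ (fun h => hbc ⟨s₁ h.1, s₁ h.2⟩) fun h => had ⟨s₁ h.1, s₁ h.2⟩,
    isNClique_expansion_map_some c₂ (fun h => hbc ⟨s₂ h.1, s₂ h.2⟩) fun h => had ⟨s₂ h.1, s₂ h.2⟩⟩

/-- The new vertex forms a triangle with every edge which joins one of `b, c` to one of `a, d`. -/
lemma isNClique_expansion_none [DecidableEq V] {p q : V} (hpq : G.Adj p q) (hp : p = a ∨ p = d)
    (hq : q = b ∨ q = c) (hab : G.Adj a b) (hac : G.Adj a c) (hdb : d ≠ b) (hdc : d ≠ c) :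
    (doubleTriangleExpansion G a b c d).IsNClique 3 {none, some p, some q} := by
  refine SimpleGraph.is3Clique_triple_iff.2 ⟨?_, ?_, hpq, ?_, ?_⟩
  · change p = a ∨ p = b ∨ p = c ∨ p = d
    tauto
  · change q = a ∨ q = b ∨ q = c ∨ q = d
    tauto
  · have := hab.ne
    have := hac.ne
    rw [Ne, Sym2.eq_iff]
    grind
  · have := hab.ne
    have := hac.ne
    rw [Ne, Sym2.eq_iff]
    grind

/-! ### Edge cuts of the expansion -/

/-- Every cut with at least two vertices on either side still has six edges after expansion: the
edges `bc` and `ad` become paths through the new vertex, so a cut does not get smaller. -/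
lemma IsTriangleRich.six_le_cut_expansion [Fintype V] (hG : IsTriangleRich G) (hab : G.Adj a b)
    (hac : G.Adj a c) (hbc : G.Adj b c) (had : G.Adj a d) (hdb : d ≠ b) (hdc : d ≠ c)
    (S : Finset (Option V)) (h2 : 2 ≤ S.card) (hS : S.card + 2 ≤ Fintype.card (Option V)) :
    inducedDegreeSum (doubleTriangleExpansion G a b c d) S + 6 ≤ 4 * S.card := by
  classical
  rw [Fintype.card_option] at hS
  obtain ⟨S, rfl | rfl⟩ := exists_eq_map_some_or_eq_insertNone S
  · rw [inducedDegreeSum_expansion_map_some hab hac hbc had hdb hdc]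
    rw [Finset.card_map] at *
    by_cases hS' : S.card + 2 ≤ Fintype.card V
    · have := hG.six_le_cut S h2 hS'
      split_ifs <;> linarith
    · -- The complement of `S` in `G` is a single vertex, so `S` contains `bc` or `ad`.
      have hc := Finset.card_compl S
      have hle := S.card_le_univ
      obtain ⟨v, hv⟩ := Finset.card_eq_one.1 (show Sᶜ.card = 1 by omega)
      have h := inducedDegreeSum_compl hG.regular S
      rw [hv, inducedDegreeSum_singleton, Finset.card_singleton] at h
      push_cast at h
      have hmem : ∀ u, u ≠ v → u ∈ S := fun u hu => by
        by_contra hn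
        exact hu (Finset.mem_singleton.1 (hv ▸ Finset.mem_compl.2 hn))
      by_cases hbcv : b ≠ v ∧ c ≠ v
      · rw [if_pos (hmem b hbcv.1), if_pos (hmem c hbcv.2)]
        split_ifs <;> linarith
      · have := hab.ne
        have := hac.ne
        rw [if_pos (hmem a (by grind)), if_pos (hmem d (by grind))]
        split_ifs <;> linarith
  · rw [inducedDegreeSum_expansion_insertNone hab hac hbc had hdb hdc]
    rw [Finset.card_insertNone] at *
    push_cast
    by_cases hS' : 2 ≤ S.card
    · have := hG.six_le_cut S hS' (by omega)
      split_ifs <;> linarith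
    · obtain ⟨v, rfl⟩ := Finset.card_eq_one.1 (show S.card = 1 by omega)
      have := hab.ne
      have := hac.ne
      have := had.ne
      have := hbc.ne
      rw [inducedDegreeSum_singleton, Finset.card_singleton]
      simp only [Finset.mem_singleton]
      split_ifs <;> simp_all

/-- As `c ∉ S`, a triangle of `G` within `S` is destroyed only if it contains `ad`. If both given
triangles are, then one of them is `abd`, and the new vertex forms a triangle with `bd`. -/
lemma HasTwoTriangles.expansion_insertNone [Fintype V] (hG : ∀ p, ∑ q, adjInd G p q = 4)
    (hab : G.Adj a b) (hac : G.Adj a c) (had : G.Adj a d) (hbc : G.Adj b c) (hdb : d ≠ b)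
    (hdc : d ≠ c) {S : Finset V} (ha : a ∈ S) (hb : b ∈ S) (hc : c ∉ S)
    (h : HasTwoTriangles G S) :
    HasTwoTriangles (doubleTriangleExpansion G a b c d) (Finset.insertNone S) := by
  classical
  have hxab := isNClique_expansion_none (c := c) (d := d) hab (.inl rfl) (.inl rfl) hab hac hdb hdc
  have hsub : ({none, some a, some b} : Finset (Option V)) ⊆ Finset.insertNone S := by
    intro z
    simp only [Finset.mem_insert, Finset.mem_singleton]
    rintro (rfl | rfl | rfl) <;> simp [ha, hb]
  have hsurv : ∀ T, T ⊆ S → G.IsNClique 3 T → ¬ (a ∈ T ∧ d ∈ T) →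
      HasTwoTriangles (doubleTriangleExpansion G a b c d) (Finset.insertNone S) := by
    intro T hTS hT hTad
    refine ⟨_, T.map .some, fun h => ?_, hsub, ?_, hxab,
      isNClique_expansion_map_some hT (fun h => hc (hTS h.2)) hTad⟩
    · have : none ∈ T.map .some := h ▸ Finset.mem_insert_self _ _
      simp at this
    · intro z hz
      obtain ⟨p, hp, rfl⟩ := Finset.mem_map.1 hz
      simpa using hTS hp
  obtain ⟨T₁, T₂, hne, s₁, s₂, c₁, c₂⟩ := h
  by_cases m₁ : a ∈ T₁ ∧ d ∈ T₁
  swap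
  · exact hsurv T₁ s₁ c₁ m₁
  by_cases m₂ : a ∈ T₂ ∧ d ∈ T₂
  swap
  · exact hsurv T₂ s₂ c₂ m₂
  by_cases hbd : G.Adj d b
  · refine ⟨_, {none, some d, some b}, fun h => ?_, hsub, ?_, hxab,
      isNClique_expansion_none hbd (.inr rfl) (.inl rfl) hab hac hdb hdc⟩
    · have : some a ∈ ({none, some d, some b} : Finset (Option V)) := h ▸ by simp
      simp [had.ne, hab.ne] at this
    · intro z
      simp only [Finset.mem_insert, Finset.mem_singleton]
      rintro (rfl | rfl | rfl) <;> simp [s₁ m₁.2, hb]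
  · -- Otherwise `a` has five neighbours: `b`, `c`, `d` and the third vertices of `T₁` and `T₂`.
    exfalso
    have third : ∀ T, T ⊆ S → G.IsNClique 3 T → a ∈ T → d ∈ T →
        ∃ u, T = {a, d, u} ∧ G.Adj a u ∧ u ≠ b ∧ u ≠ c ∧ u ≠ d := by
      intro T hTS hT haT hdT
      have hcard : ((T.erase a).erase d).card = 1 := by
        rw [Finset.card_erase_of_mem (Finset.mem_erase.2 ⟨had.ne', hdT⟩),
          Finset.card_erase_of_mem haT, hT.card_eq]
      obtain ⟨u, hu⟩ := Finset.card_eq_one.1 hcard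
      have hu' : u ∈ (T.erase a).erase d := hu ▸ Finset.mem_singleton_self u
      simp only [Finset.mem_erase] at hu'
      refine ⟨u, ?_, hT.isClique haT hu'.2.2 (Ne.symm hu'.2.1), ?_, ?_, hu'.1⟩
      · rw [← hu, Finset.insert_erase (Finset.mem_erase.2 ⟨had.ne', hdT⟩),
          Finset.insert_erase haT]
      · rintro rfl
        exact hbd (hT.isClique hdT hu'.2.2 hdb)
      · rintro rfl
        exact hc (hTS hu'.2.2)
    obtain ⟨u, hu, hau, hub, huc, hud⟩ := third T₁ s₁ c₁ m₁.1 m₁.2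
    obtain ⟨w, hw, haw, hwb, hwc, hwd⟩ := third T₂ s₂ c₂ m₂.1 m₂.2
    have huw : u ≠ w := fun h => hne (by rw [hu, hw, h])
    have hle : ∑ q ∈ {b, c, d, u, w}, adjInd G a q ≤ ∑ q, adjInd G a q :=
      Finset.sum_le_sum_of_subset_of_nonneg (Finset.subset_univ _) fun q _ _ => by
        unfold adjInd; split_ifs <;> simp
    rw [hG, Finset.sum_insert (by simp [hbc.ne, hdb.symm, hub.symm, hwb.symm]),
      Finset.sum_insert (by simp [hdc.symm, huc.symm, hwc.symm]),
      Finset.sum_insert (by simp [hud.symm, hwd.symm]), Finset.sum_pair huw, adjInd_of_adj hab,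
      adjInd_of_adj hac, adjInd_of_adj had, adjInd_of_adj hau, adjInd_of_adj haw] at hle
    norm_num at hle

/-- The complement of a triangle of `G` is a side of a six-edge cut. -/
lemma IsTriangleRich.hasTwoTriangles_compl [Fintype V] [DecidableEq V] (hG : IsTriangleRich G)
    (hcard : 7 ≤ Fintype.card V) {p q r : V} (hpq : G.Adj p q) (hpr : G.Adj p r)
    (hqr : G.Adj q r) : HasTwoTriangles G {p, q, r}ᶜ := by
  have h3 : ({p, q, r} : Finset V).card = 3 :=
    Finset.card_eq_three.2 ⟨_, _, _, hpq.ne, hpr.ne, hqr.ne, rfl⟩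
  have hc := Finset.card_compl ({p, q, r} : Finset V)
  have h := inducedDegreeSum_compl hG.regular {p, q, r}
  rw [inducedDegreeSum_of_isNClique hpq hpr hqr, h3] at h
  push_cast at h
  exact hG.hasTwoTriangles _ (by omega) (by omega) (by linarith)

/-- A side of a six-edge cut which does not contain the new vertex contains neither `bc` nor `ad`,
so its triangles survive the expansion. -/
lemma IsTriangleRich.hasTwoTriangles_expansion_map_some [Fintype V] [DecidableEq V]
    (hG : IsTriangleRich G)
    (hab : G.Adj a b) (hac : G.Adj a c) (hbc : G.Adj b c) (had : G.Adj a d) (hdb : d ≠ b)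
    (hdc : d ≠ c) {S : Finset V} (h5 : 5 ≤ S.card) (hS : S.card + 2 ≤ Fintype.card V)
    (h : inducedDegreeSum (doubleTriangleExpansion G a b c d) (S.map .some) + 6 = 4 * S.card) :
    HasTwoTriangles (doubleTriangleExpansion G a b c d) (S.map .some) := by
  have h6 := hG.six_le_cut S (by omega) hS
  have h' := inducedDegreeSum_expansion_map_some hab hac hbc had hdb hdc S
  have hbcS : ¬ (b ∈ S ∧ c ∈ S) := by
    rintro ⟨hb, hc⟩
    rw [if_pos hb, if_pos hc] at h'
    split_ifs at h' <;> linarith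
  have hadS : ¬ (a ∈ S ∧ d ∈ S) := by
    rintro ⟨ha, hd⟩
    rw [if_pos ha, if_pos hd] at h'
    split_ifs at h' <;> linarith
  by_cases hS' : S.card + 3 ≤ Fintype.card V
  · refine (hG.hasTwoTriangles S (by omega) hS' ?_).expansion hbcS hadS
    have e1 : (if b ∈ S then (1 : ℤ) else 0) * (if c ∈ S then 1 else 0) = 0 := by
      split_ifs <;> simp_all
    have e2 : (if a ∈ S then (1 : ℤ) else 0) * (if d ∈ S then 1 else 0) = 0 := by
      split_ifs <;> simp_all
    rw [e1, e2] at h'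
    linarith
  · -- The complement of `S` in `G` consists of two vertices `p` and `q`, which form a triangle
    -- with the new vertex.
    have hc := Finset.card_compl S
    obtain ⟨p, q, hpq, hSc⟩ := Finset.card_eq_two.1 (show Sᶜ.card = 2 by omega)
    have hmem : ∀ u, u ∈ S ↔ u ≠ p ∧ u ≠ q := fun u => by
      rw [← not_iff_not, ← Finset.mem_compl, hSc]
      simp only [Finset.mem_insert, Finset.mem_singleton]
      tauto
    -- It suffices to find a triangle of `G` which contains `p` and `q`.
    have key : ∀ {u v w : V}, G.Adj u v → G.Adj u w → G.Adj v w →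
        ({u, v, w} : Finset V)ᶜ ⊆ S →
        HasTwoTriangles (doubleTriangleExpansion G a b c d) (S.map .some) := by
      intro u v w huv huw hvw hsub
      have := hG.hasTwoTriangles_compl (by omega) huv huw hvw
      exact (this.expansion (fun h => hbcS ⟨hsub h.1, hsub h.2⟩)
        fun h => hadS ⟨hsub h.1, hsub h.2⟩).mono (Finset.map_subset_map.2 hsub)
    have hadj : G.Adj p q := by
      have hcut := inducedDegreeSum_compl hG.regular S
      rw [hSc, inducedDegreeSum_pair G hpq, Finset.card_pair hpq] at hcut
      rcases adjInd_cases G p q with hq | hq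
      · exact hq.1
      · rw [hq.2] at hcut
        split_ifs at h' <;> push_cast at hcut <;> linarith
    rw [hmem, hmem] at hbcS hadS
    have hpq' : (p = a ∨ p = d) ∧ (q = b ∨ q = c) ∨ (q = a ∨ q = d) ∧ (p = b ∨ p = c) := by
      have := hab.ne
      have := hac.ne
      have := had.ne
      have := hbc.ne
      grind
    have hsub : ∀ T : Finset V, p ∈ T → q ∈ T → Tᶜ ⊆ S := by
      intro T hp hq u hu
      rw [Finset.mem_compl] at hu
      exact (hmem u).2 ⟨fun h => hu (h ▸ hp), fun h => hu (h ▸ hq)⟩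
    have hpq'' := hadj.symm
    rcases hpq' with ⟨rfl | rfl, rfl | rfl⟩ | ⟨rfl | rfl, rfl | rfl⟩
    · exact key hab hac hbc (hsub _ (by simp) (by simp))
    · exact key hab hac hbc (hsub _ (by simp) (by simp))
    · exact key hab had hpq'' (hsub _ (by simp) (by simp))
    · exact key hac had hpq'' (hsub _ (by simp) (by simp))
    · exact key hab hac hbc (hsub _ (by simp) (by simp))
    · exact key hab hac hbc (hsub _ (by simp) (by simp))
    · exact key hab had hadj (hsub _ (by simp) (by simp))
    · exact key hac had hadj (hsub _ (by simp) (by simp))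

/-- A side of a six-edge cut which contains the new vertex contains an end of `bc` and an end of
`ad`, so its restriction to `G` is a side of a six-edge cut of `G`. -/
lemma IsTriangleRich.hasTwoTriangles_expansion_insertNone [Fintype V] (hG : IsTriangleRich G)
    (hab : G.Adj a b) (hac : G.Adj a c) (hbc : G.Adj b c) (had : G.Adj a d) (hdb : d ≠ b)
    (hdc : d ≠ c) {S : Finset V} (h4 : 4 ≤ S.card) (hS : S.card + 3 ≤ Fintype.card V)
    (h : inducedDegreeSum (doubleTriangleExpansion G a b c d) (Finset.insertNone S) + 6 =
      4 * (S.card + 1)) :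
    HasTwoTriangles (doubleTriangleExpansion G a b c d) (Finset.insertNone S) := by
  classical
  have h6 := hG.six_le_cut S (by omega) (by omega)
  have h' := inducedDegreeSum_expansion_insertNone hab hac hbc had hdb hdc S
  have hbcS : b ∈ S ∨ c ∈ S := by
    by_contra! hn
    rw [if_neg hn.1, if_neg hn.2] at h'
    split_ifs at h' <;> linarith
  have hadS : a ∈ S ∨ d ∈ S := by
    by_contra! hn
    rw [if_neg hn.1, if_neg hn.2] at h'
    split_ifs at h' <;> linarith
  have htwo : HasTwoTriangles G S := by
    refine hG.hasTwoTriangles S h4 hS ?_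
    split_ifs at h' <;> linarith
  by_cases ha : a ∈ S
  · by_cases hb : b ∈ S
    · by_cases hc : c ∈ S
      · refine ⟨{none, some a, some b}, {none, some a, some c}, fun h => ?_, ?_, ?_,
          isNClique_expansion_none hab (.inl rfl) (.inl rfl) hab hac hdb hdc,
          isNClique_expansion_none hac (.inl rfl) (.inr rfl) hab hac hdb hdc⟩
        · have : some b ∈ ({none, some a, some c} : Finset (Option V)) := h ▸ by simp
          simp [hab.ne', hbc.ne] at this
        all_goals
          intro z
          simp only [Finset.mem_insert, Finset.mem_singleton]
          rintro (rfl | rfl | rfl) <;> simp [ha, hb, hc]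
      · exact htwo.expansion_insertNone hG.regular hab hac had hbc hdb hdc ha hb hc
    · have hc : c ∈ S := hbcS.resolve_left hb
      rw [doubleTriangleExpansion_swap]
      exact htwo.expansion_insertNone hG.regular hac hab had hbc.symm hdc hdb ha hc hb
  · have hd : d ∈ S := hadS.resolve_left ha
    by_cases hbc' : b ∈ S ∧ c ∈ S
    · -- Moving `a`, which has three neighbours in `insertNone S`, to this side makes the cut too
      -- small.
      exfalso
      have hcut := hG.six_le_cut_expansion hab hac hbc had hdb hdc
        (Finset.insertNone (insert a S))
        (by rw [Finset.card_insertNone, Finset.card_insert_of_notMem ha]; omega)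
        (by rw [Finset.card_insertNone, Finset.card_insert_of_notMem ha, Fintype.card_option]
            omega)
      rw [inducedDegreeSum_expansion_insertNone hab hac hbc had hdb hdc,
        inducedDegreeSum_insert G ha, Finset.card_insertNone,
        Finset.card_insert_of_notMem ha] at hcut
      have hle : ∑ q ∈ {b, c, d}, adjInd G a q ≤ ∑ q ∈ S, adjInd G a q := by
        refine Finset.sum_le_sum_of_subset_of_nonneg ?_ fun q _ _ => ?_
        · intro z
          simp only [Finset.mem_insert, Finset.mem_singleton]
          rintro (rfl | rfl | rfl)
          exacts [hbc'.1, hbc'.2, hd]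
        · unfold adjInd; split_ifs <;> simp
      rw [Finset.sum_insert (by simp [hbc.ne, hdb.symm]), Finset.sum_pair hdc.symm,
        adjInd_of_adj hab, adjInd_of_adj hac, adjInd_of_adj had] at hle
      simp only [Finset.mem_insert, true_or, hbc'.1, hbc'.2, hd, or_true, if_true, ha,
        if_false] at hcut h'
      push_cast at hcut
      linarith
    · refine (htwo.expansion hbc' fun h => ha h.1).mono fun z hz => ?_
      obtain ⟨p, hp, rfl⟩ := Finset.mem_map.1 hz
      simpa using hp

theorem IsTriangleRich.expansion [Fintype V] (hG : IsTriangleRich G)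
    (hab : G.Adj a b) (hac : G.Adj a c) (hbc : G.Adj b c) (had : G.Adj a d) (hdb : d ≠ b)
    (hdc : d ≠ c) : IsTriangleRich (doubleTriangleExpansion G a b c d) where
  five_le_card := by
    have := hG.five_le_card
    rw [Fintype.card_option]
    omega
  regular := sum_adjInd_expansion hG.regular hab hac hbc had hdb hdc
  six_le_cut := hG.six_le_cut_expansion hab hac hbc had hdb hdc
  hasTwoTriangles S h4 hS h := by
    classical
    rcases h4.eq_or_lt with h4 | h5
    · exact hasTwoTriangles_of_card_eq_four h4.symm (by rw [← h4] at h; push_cast at h; linarith)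
    rw [Fintype.card_option] at hS
    obtain ⟨S, rfl | rfl⟩ := exists_eq_map_some_or_eq_insertNone S
    · rw [Finset.card_map] at *
      exact hG.hasTwoTriangles_expansion_map_some hab hac hbc had hdb hdc h5 (by omega) h
    · rw [Finset.card_insertNone] at *
      exact hG.hasTwoTriangles_expansion_insertNone hab hac hbc had hdb hdc (by omega) (by omega)
        (by push_cast at h; exact h)

end Expansion

/-! ### Four triangles -/

lemma IsTriangleRich.adj_of_card_eq_five [Fintype V] {G : SimpleGraph V} (hG : IsTriangleRich G)
    (hV : Fintype.card V = 5) {p q : V} (hpq : p ≠ q) : G.Adj p q := by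
  classical
  by_contra hn
  have h4 := hG.regular p
  have hsub : ∑ r ∈ {p, q}ᶜ, adjInd G p r = ∑ r, adjInd G p r := by
    refine Finset.sum_subset (Finset.subset_univ _) fun r _ hr => ?_
    rw [Finset.mem_compl, not_not, Finset.mem_insert, Finset.mem_singleton] at hr
    rcases hr with rfl | rfl
    · exact adjInd_self _ _
    · exact adjInd_of_not_adj hn
  have hle : ∑ r ∈ {p, q}ᶜ, adjInd G p r ≤ ∑ r ∈ ({p, q} : Finset V)ᶜ, 1 :=
    Finset.sum_le_sum fun r _ => adjInd_le_one G p r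
  rw [hsub, h4, Finset.sum_const, Finset.card_compl, Finset.card_pair hpq, hV] at hle
  norm_num at hle

theorem IsTriangleRich.four_le_tri_expansion {V : Type u} [Fintype V] {G : SimpleGraph V}
    {a b c d : V} (hG : IsTriangleRich G) (hab : G.Adj a b) (hac : G.Adj a c) (hbc : G.Adj b c)
    (had : G.Adj a d) (hdb : d ≠ b) (hdc : d ≠ c) :
    4 ≤ tri (doubleTriangleExpansion G a b c d) := by
  classical
  have h1 := isNClique_expansion_none (c := c) (d := d) hab (.inl rfl) (.inl rfl) hab hac hdb hdc
  have h2 := isNClique_expansion_none (b := b) (d := d) hac (.inl rfl) (.inr rfl) hab hac hdb hdc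
  have h12 : ({none, some a, some b} : Finset (Option V)) ≠ {none, some a, some c} := by
    intro h
    have : some b ∈ ({none, some a, some c} : Finset (Option V)) := h ▸ by simp
    simp [hab.ne', hbc.ne] at this
  rcases hG.five_le_card.eq_or_lt with h5 | h6
  · have h3 := isNClique_expansion_none (a := a) (c := c)
      (hG.adj_of_card_eq_five h5.symm hdb) (.inr rfl) (.inl rfl) hab hac hdb hdc
    have h4 := isNClique_expansion_none (a := a) (b := b)
      (hG.adj_of_card_eq_five h5.symm hdc) (.inr rfl) (.inr rfl) hab hac hdb hdc
    have hne : ∀ {q r : V}, a ≠ q →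
        ({none, some a, some r} : Finset (Option V)) ≠ {none, some d, some q} := by
      intro q r haq h
      have : some a ∈ ({none, some d, some q} : Finset (Option V)) := h ▸ by simp
      simp [had.ne, haq] at this
    have h34 : ({none, some d, some b} : Finset (Option V)) ≠ {none, some d, some c} := by
      intro h
      have : some b ∈ ({none, some d, some c} : Finset (Option V)) := h ▸ by simp
      simp [hdb.symm, hbc.ne] at this
    exact four_le_tri h1 h2 h3 h4 h12 (hne hab.ne) (hne hac.ne) (hne hab.ne) (hne hac.ne) h34
  · have hH := hG.expansion hab hac hbc had hdb hdc
    obtain ⟨x1, x2, x3⟩ := SimpleGraph.is3Clique_triple_iff.1 h1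
    obtain ⟨T₃, T₄, h34, s3, s4, h3, h4⟩ :=
      hH.hasTwoTriangles_compl (by rw [Fintype.card_option]; omega) x1 x2 x3
    have hne : ∀ {T : Finset (Option V)} {r : V}, T ⊆ {none, some a, some b}ᶜ →
        {none, some a, some r} ≠ T := by
      rintro T r hT rfl
      have := hT (Finset.mem_insert_self _ _)
      simp at this
    exact four_le_tri h1 h2 h3 h4 h12 (hne s3) (hne s4) (hne s3) (hne s4) h34

theorem IsDTDescendant.isTriangleRich_and_four_le_tri {V : Type u} {G : SimpleGraph V}
    (hG : IsDTDescendant (SimpleGraph.completeGraph (Fin 5)) G) :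
    ∃ _ : Fintype V, IsTriangleRich G ∧ 4 ≤ tri G := by
  induction hG with
  | refl h =>
    obtain ⟨e⟩ := h
    have := Fintype.ofEquiv _ e.symm.toEquiv
    exact ⟨this, isTriangleRich_completeGraph_five.of_iso e.symm,
      four_le_tri_completeGraph_five.trans (tri_le_of_iso e.symm)⟩
  | step _ hGH ih =>
    obtain ⟨_, hG, -⟩ := ih
    obtain ⟨a, b, c, d, hab, hac, hbc, had, hdb, hdc, ⟨e⟩⟩ := hGH
    have := Fintype.ofEquiv _ e.symm.toEquiv
    exact ⟨this, (hG.expansion hab hac hbc had hdb hdc).of_iso e.symm,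
      (hG.four_le_tri_expansion hab hac hbc had hdb hdc).trans (tri_le_of_iso e.symm)⟩

end

theorem mainTheorem1 {V : Type u} (G : SimpleGraph V)
    (hG : IsDTDescendant (SimpleGraph.completeGraph (Fin 5)) G) : 4 ≤ tri G := by
  obtain ⟨_, -, h⟩ := hG.isTriangleRich_and_four_le_tri
  exact h
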